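/- Let $k$ be a field and let $1\le a\le\infty$. Let $A=\bigoplus_{0\le i<a}A_i$ be a graded tdvr (graded truncated discrete valuation ring) of length $a$, that is, a commutative graded ring with $A_0=k$ such that for every $0\le i<a$ the part $A_i$ is a one-dimensional $k$-vector space generated by $(A_1)^i$ (for $a=\infty$ the sum is the usual infinite direct sum; thus $A\cong k[\varpi]/(\varpi^a)$ if $a<\infty$ and $A\cong k[\varpi]$ if $a=\infty$, graded by the degree in $\varpi$). Let $R=A[x_1,\dots,x_n]$ and $L=Re_1\oplus\dots\oplus Re_r$, and grade $L$ as $L=\bigoplus_{0\le i<a}L_i$, where $L_i$ consists of the elements of $L$ all of whose coefficients lie in $A_i$ (so the $x_j$ and $e_l$ have degree $0$). A power product in $L$ is an element $X=\boldsymbol{x}e_l$ with $\boldsymbol{x}$ a monomial in $x_1,\dots,x_n$. Fix a term order on the power products in $L$: a total order such that $X<\boldsymbol{x}X$ for every monomial $\boldsymbol{x}\ne1$, and $X<Y$ implies $\boldsymbol{x}X<\boldsymbol{x}Y$ for every monomial $\boldsymbol{x}$. For $0\ne f\in L$ let $\operatorname{lp}(f)$ be the largest power product that occurs in $f$, $\operatorname{lc}(f)\in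 A$ its coefficient, and $\operatorname{lt}(f)=\operatorname{lc}(f)\operatorname{lp}(f)$; put $\operatorname{lt}(0)=0$ and regard $\operatorname{lp}(0)$ as smaller than every power product. For a finite set $F=\{f_1,\dots,f_s\}\subset L\smallsetminus\{0\}$ write $f\to h$ if there are $a_i\in A$ and monomials $\boldsymbol{x}_i$ with $h=f-\sum_i a_i\boldsymbol{x}_if_i$, with $\operatorname{lp}(f)=\boldsymbol{x}_i\operatorname{lp}(f_i)$ whenever $a_i\ne0$, and with $\operatorname{lt}(f)=\sum_i a_i\boldsymbol{x}_i\operatorname{lt}(f_i)$. The element $f$ can be strictly reduced with respect to $F$ if there is a finite chain $f\to h_1\to\dots\to h$ of at least one such step with $\operatorname{lp}(h)<\operatorname{lp}(f)$ (the case $h=0$ included). Let $M$ be a nonzero graded $R$-submodule of $L$, i.e. $M=\bigoplus_i (M\cap L_i)$. Let $G=\{g_1,\dots,g_t\}$ be a homogeneous Gröbner basis for $M$: a finite subset of $M\smallsetminus\{0\}$ whose elements each lie in some $L_i$ and whose leading terms generate the same $R$-submodule of $L$ as the leading terms of all elements of $M$. Suppose that $G$ is minimal, i.e. no $g\in G$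 can be strictly reduced with respect to $G\smallsetminus\{g\}$. Then $L/M$ is flat over $A$ if and only if $\operatorname{lc}(g_j)$ is a unit of $A$ for every $1\le j\le t$. -/

import Mathlib

namespace GroebnerFlat

/-- Power products `x^m e_l` of the free module `R e_1 ⊕ ⋯ ⊕ R e_r`, `R = A[x_1, …, x_n]`.
Power products `x^m` of `R` itself are represented by their exponents `m : Fin n →₀ ℕ`. -/
@[ext]
structure PowerProduct (n r : ℕ) where
  exponent : Fin n →₀ ℕ
  index : Fin r

/-- The product of `x^d` with the power product `x^m e_l`, namely `x^(d + m) e_l`. -/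
noncomputable def PowerProduct.shift {n r : ℕ} (d : Fin n →₀ ℕ) (X : PowerProduct n r) : PowerProduct n r :=
  ⟨d + X.exponent, X.index⟩

/-- The given total order on power products is a term order. -/
structure IsTermOrder (n r : ℕ) [LinearOrder (PowerProduct n r)] : Prop where
  lt_shift : ∀ (X : PowerProduct n r) (d : Fin n →₀ ℕ), d ≠ 0 → X < X.shift d
  shift_lt_shift : ∀ (X Y : PowerProduct n r) (d : Fin n →₀ ℕ),
    X < Y → X.shift d < Y.shift d

/-- The free module `L = R e_1 ⊕ ⋯ ⊕ R e_r` over `R = A[x_1, …, x_n]`. -/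
abbrev FreeMod (A : Type*) [CommRing A] (n r : ℕ) : Type _ := Fin r → MvPolynomial (Fin n) A

noncomputable section

section LeadingTerms

variable {A : Type*} [CommRing A] {n r : ℕ}

/-- The coefficient in `A` of the power product `X` in `f`. -/
def coeffAt (f : FreeMod A n r) (X : PowerProduct n r) : A :=
  MvPolynomial.coeff X.exponent (f X.index)

/-- The element `c X` of `L`. -/
def monomialElt (c : A) (X : PowerProduct n r) : FreeMod A n r :=
  Pi.single X.index (MvPolynomial.monomial X.exponent c)

theorem finite_coeffAt_ne_zero (f : FreeMod A n r) : {X | coeffAt f X ≠ 0}.Finite := by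
  classical
  refine (Set.finite_iUnion fun l : Fin r =>
    ((f l).support.finite_toSet.image fun m => PowerProduct.mk m l)).subset ?_
  intro X hX
  refine Set.mem_iUnion.2 ⟨X.index, X.exponent, ?_, rfl⟩
  exact Finset.mem_coe.2 (MvPolynomial.mem_support_iff.2 hX)

/-- The finite set of the power products that occur in `f`. -/
def supp (f : FreeMod A n r) : Finset (PowerProduct n r) := (finite_coeffAt_ne_zero f).toFinset

variable [LinearOrder (PowerProduct n r)]

/-- The leading power product, with the convention that `leadMonomial 0 = ⊥` lies below every power
product. -/
def leadMonomial (f : FreeMod A n r) : WithBot (PowerProduct n r) := (supp f).max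

/-- The leading coefficient (`0` for `f = 0`). -/
def leadCoeff (f : FreeMod A n r) : A :=
  WithBot.recBotCoe 0 (fun X => coeffAt f X) (leadMonomial f)

/-- The leading term (`0` for `f = 0`). -/
def leadTerm (f : FreeMod A n r) : FreeMod A n r :=
  WithBot.recBotCoe 0 (fun X => monomialElt (leadCoeff f) X) (leadMonomial f)

/-- The submodule generated by the leading terms of the elements of `S`. -/
def ltSubmodule (S : Set (FreeMod A n r)) : Submodule (MvPolynomial (Fin n) A) (FreeMod A n r) :=
  Submodule.span (MvPolynomial (Fin n) A) (leadTerm '' S)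

/-- `G` is a Gröbner basis for the submodule `M`. -/
def IsGroebnerBasis (G : Finset (FreeMod A n r))
    (M : Submodule (MvPolynomial (Fin n) A) (FreeMod A n r)) : Prop :=
  (∀ g ∈ G, g ∈ M ∧ g ≠ 0) ∧
    ltSubmodule (G : Set (FreeMod A n r)) = ltSubmodule (M : Set (FreeMod A n r))

/-- One reduction step `f → h` modulo `F`. The polynomial `monomial (d p) (c p)` is
`c_p x^(d_p)`. -/
def ReducesStep (F : Finset (FreeMod A n r)) (f h : FreeMod A n r) : Prop :=
  ∃ (c : FreeMod A n r → A) (d : FreeMod A n r → (Fin n →₀ ℕ)),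
    h = f - ∑ p ∈ F, MvPolynomial.monomial (d p) (c p) • p ∧
    (∀ p ∈ F, c p ≠ 0 → leadMonomial f = (leadMonomial p).map (PowerProduct.shift (d p))) ∧
    leadTerm f = ∑ p ∈ F, MvPolynomial.monomial (d p) (c p) • leadTerm p

/-- `f` reduces to `h` modulo `F`, by a finite nonempty chain of reduction steps. -/
def Reduces (F : Finset (FreeMod A n r)) (f h : FreeMod A n r) : Prop :=
  Relation.TransGen (ReducesStep F) f h

/-- `f` reduces strictly to `h` modulo `F`. -/
def ReducesStrictly (F : Finset (FreeMod A n r)) (f h : FreeMod A n r) : Prop :=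
  Reduces F f h ∧ leadMonomial h < leadMonomial f

open Classical in
/-- Minimality: no `g ∈ G` can be strictly reduced with respect to `G \ {g}`. -/
def IsMinimalBasis (G : Finset (FreeMod A n r)) : Prop :=
  ∀ g ∈ G, ¬ ∃ h, ReducesStrictly (G.erase g) g h

end LeadingTerms

section Graded

variable {k A : Type*} [Field k] [CommRing A] [Algebra k A]

/-- The grading `A = ⊕_i 𝒜 i` of the `k`-algebra `A` makes it a graded truncated discrete
valuation ring of length `a ≤ ∞`: there is nothing in degrees `≥ a`, and for `i < a` the
part `𝒜 i` is one-dimensional over `k` and spanned by the `i`-fold products of elements of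
`𝒜 1`. For `i = 0` the latter says that `𝒜 0` is the image of `k`. -/
structure IsGradedTdvr (𝒜 : ℕ → Submodule k A) [GradedAlgebra 𝒜] (a : ℕ∞) : Prop where
  length_pos : 0 < a
  finrank_eq_one : ∀ i : ℕ, (i : ℕ∞) < a → Module.finrank k (𝒜 i) = 1
  eq_pow : ∀ i : ℕ, (i : ℕ∞) < a → 𝒜 i = 𝒜 1 ^ i
  eq_bot : ∀ i : ℕ, a ≤ (i : ℕ∞) → 𝒜 i = ⊥

variable {n r : ℕ}

/-- The degree-`i` part `L_i` of `L`: all coefficients lie in `𝒜 i`. -/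
def degreePart (𝒜 : ℕ → Submodule k A) (n r i : ℕ) : Submodule k (FreeMod A n r) where
  carrier := {f | ∀ X, coeffAt f X ∈ 𝒜 i}
  add_mem' {f g} hf hg X := by
    have h : coeffAt (f + g) X = coeffAt f X + coeffAt g X := by simp [coeffAt]
    rw [h]
    exact (𝒜 i).add_mem (hf X) (hg X)
  zero_mem' X := by simp [coeffAt]
  smul_mem' c f hf X := by
    have h : coeffAt (c • f) X = c • coeffAt f X := by simp [coeffAt]
    rw [h]
    exact (𝒜 i).smul_mem c (hf X)

/-- `M` is a graded submodule: it is the sum of its parts `M ∩ L_i`. The sum is direct because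
the sum of the `L_i` is. -/
def IsGradedSubmodule (𝒜 : ℕ → Submodule k A)
    (M : Submodule (MvPolynomial (Fin n) A) (FreeMod A n r)) : Prop :=
  M.restrictScalars k = ⨆ i, M.restrictScalars k ⊓ degreePart 𝒜 n r i

/-- `g` is a nonzero homogeneous element of `L`. -/
def IsHomogeneousElt (𝒜 : ℕ → Submodule k A) (g : FreeMod A n r) : Prop :=
  g ≠ 0 ∧ ∃ i, g ∈ degreePart 𝒜 n r i

end Graded

end

end GroebnerFlat

open GroebnerFlat

/-!
If the leading coefficients of `G` are units, division by `G` shows that the power products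
divisible by no `lp(g)` form an `A`-basis of `L/M`.

Conversely, let `L/M` be flat. The expansion of a homogeneous `m ∈ M` in power products is a linear
relation between their classes in `L/M`; the equational criterion for flatness, followed by
projection to the right degrees, turns it into an expression of `m` as an `A`-linear combination of
elements of `M ∩ L₀`. These have coefficients in `A₀ = k`, so `M` is stable under applying a
`k`-linear map `A → A` to all coefficients. Applying `A → k → A` for a functional that does not
vanish on `lc(g)` to an element `g` of `G` gives an element of `M` with leading power product
`lp(g)` and leading coefficient in `k^×`. Comparing leading terms modulo the irrelevant ideal, some
`h ∈ G` has `lp(h) ∣ lp(g)` and `lc(h)` of degree `0`, hence a unit; minimality forces `h = g`.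
-/

namespace GroebnerFlat

section Coefficients

variable {k A B : Type*} [CommRing k] [CommRing A] [Algebra k A] [CommRing B] [Algebra k B]
  {n r : ℕ}

/-- The power products as a basis of `L` over `A`, with `coeffAt f X` the coordinate of `f`
at `X`. -/
noncomputable def powerProductBasis (A : Type*) [CommRing A] (n r : ℕ) :
    Module.Basis (PowerProduct n r) A (FreeMod A n r) :=
  (Pi.basis fun _ => MvPolynomial.basisMonomials (Fin n) A).reindex
    { toFun := fun x => ⟨x.2, x.1⟩
      invFun := fun X => ⟨X.index, X.exponent⟩ }

theorem powerProductBasis_repr_apply (f : FreeMod A n r) (X : PowerProduct n r) :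
    (powerProductBasis A n r).repr f X = coeffAt f X := by
  simp only [powerProductBasis, Module.Basis.repr_reindex_apply, Pi.basis_repr]
  rfl

theorem ext_coeffAt {f g : FreeMod A n r} (h : ∀ X, coeffAt f X = coeffAt g X) : f = g :=
  (powerProductBasis A n r).ext_elem fun X => by
    simpa only [powerProductBasis_repr_apply] using h X

theorem coeffAt_zero (X : PowerProduct n r) : coeffAt (0 : FreeMod A n r) X = 0 := by
  simp [coeffAt]

theorem coeffAt_add (f g : FreeMod A n r) (X : PowerProduct n r) :
    coeffAt (f + g) X = coeffAt f X + coeffAt g X := by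
  simp [coeffAt]

theorem coeffAt_sub (f g : FreeMod A n r) (X : PowerProduct n r) :
    coeffAt (f - g) X = coeffAt f X - coeffAt g X := by
  simp [coeffAt]

theorem coeffAt_smul (c : A) (f : FreeMod A n r) (X : PowerProduct n r) :
    coeffAt (c • f) X = c * coeffAt f X := by
  simp [coeffAt]

theorem coeffAt_polynomial_smul (p : MvPolynomial (Fin n) A) (f : FreeMod A n r)
    (X : PowerProduct n r) :
    coeffAt (p • f) X = ∑ x ∈ Finset.HasAntidiagonal.antidiagonal X.exponent,
      MvPolynomial.coeff x.1 p * coeffAt f ⟨x.2, X.index⟩ := by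
  simp [coeffAt, MvPolynomial.coeff_mul]

theorem coeffAt_monomial_smul_shift (d : Fin n →₀ ℕ) (c : A) (f : FreeMod A n r)
    (X : PowerProduct n r) :
    coeffAt (MvPolynomial.monomial d c • f) (X.shift d) = c * coeffAt f X := by
  simp [coeffAt, PowerProduct.shift]

theorem coeffAt_monomial_smul_of_forall_ne {d : Fin n →₀ ℕ} {X : PowerProduct n r}
    (h : ∀ Y : PowerProduct n r, X ≠ Y.shift d) (c : A) (f : FreeMod A n r) :
    coeffAt (MvPolynomial.monomial d c • f) X = 0 := by
  have hd : ¬ d ≤ X.exponent := fun hd =>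
    h ⟨X.exponent - d, X.index⟩ (PowerProduct.ext (add_tsub_cancel_of_le hd).symm rfl)
  simp [coeffAt, MvPolynomial.coeff_monomial_mul', hd]

theorem coeffAt_monomialElt_self (c : A) (X : PowerProduct n r) :
    coeffAt (monomialElt c X) X = c := by
  simp [coeffAt, monomialElt]

theorem coeffAt_monomialElt_of_ne {X Y : PowerProduct n r} (h : X ≠ Y) (c : A) :
    coeffAt (monomialElt c X) Y = 0 := by
  by_cases hl : Y.index = X.index
  · have hm : X.exponent ≠ Y.exponent := fun hm => h (PowerProduct.ext hm hl.symm)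
    simp [coeffAt, monomialElt, hl, MvPolynomial.coeff_monomial, hm]
  · simp [coeffAt, monomialElt, hl]

theorem monomial_smul_monomialElt (d : Fin n →₀ ℕ) (c e : A) (X : PowerProduct n r) :
    MvPolynomial.monomial d c • monomialElt e X = monomialElt (c * e) (X.shift d) := by
  rw [monomialElt, ← Pi.single_smul, smul_eq_mul, MvPolynomial.monomial_mul]
  rfl

theorem mem_supp {f : FreeMod A n r} {X : PowerProduct n r} : X ∈ supp f ↔ coeffAt f X ≠ 0 := by
  simp [supp]

theorem sum_coeffAt_smul_powerProductBasis (f : FreeMod A n r) :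
    ∑ X : supp f, coeffAt f X • powerProductBasis A n r X = f := by
  have hsupp : ((powerProductBasis A n r).repr f).support = supp f := by
    ext X
    rw [Finsupp.mem_support_iff, powerProductBasis_repr_apply, mem_supp]
  conv_rhs => rw [← (powerProductBasis A n r).linearCombination_repr f,
    Finsupp.linearCombination_apply, Finsupp.sum, hsupp]
  simp_rw [powerProductBasis_repr_apply]
  exact Finset.sum_coe_sort (supp f) fun X => coeffAt f X • powerProductBasis A n r X

/-- The map of free modules that applies the linear map `φ` to every coefficient. -/
noncomputable def mapCoeff (φ : A →ₗ[k] B) : FreeMod A n r →ₗ[k] FreeMod B n r :=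
  (powerProductBasis B n r).repr.symm.toLinearMap.restrictScalars k ∘ₗ
    Finsupp.mapRange.linearMap φ ∘ₗ (powerProductBasis A n r).repr.toLinearMap.restrictScalars k

theorem coeffAt_mapCoeff (φ : A →ₗ[k] B) (f : FreeMod A n r) (X : PowerProduct n r) :
    coeffAt (mapCoeff φ f) X = φ (coeffAt f X) := by
  simp [← powerProductBasis_repr_apply, mapCoeff]

end Coefficients

section LeadingTerms

variable {A : Type*} [CommRing A] {n r : ℕ} [LinearOrder (PowerProduct n r)]

theorem leadMonomial_lt_coe {f : FreeMod A n r} {X : PowerProduct n r} :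
    leadMonomial f < X ↔ ∀ Y, X ≤ Y → coeffAt f Y = 0 := by
  rw [leadMonomial, Finset.max, Finset.sup_lt_iff (WithBot.bot_lt_coe X)]
  refine forall_congr' fun Y => ?_
  rw [mem_supp, WithBot.coe_lt_coe, ← not_le, not_imp_not]

theorem leadMonomial_eq_coe {f : FreeMod A n r} {X : PowerProduct n r} :
    leadMonomial f = X ↔ coeffAt f X ≠ 0 ∧ ∀ Y, X < Y → coeffAt f Y = 0 := by
  constructor
  · refine fun h => ⟨mem_supp.1 (Finset.mem_of_max h), fun Y hY => ?_⟩
    exact leadMonomial_lt_coe.1 (h ▸ WithBot.coe_lt_coe.2 hY) Y le_rfl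
  · rintro ⟨hX, hlt⟩
    refine le_antisymm (Finset.max_le fun Y hY => ?_) (Finset.le_max (mem_supp.2 hX))
    exact WithBot.coe_le_coe.2 (not_lt.1 fun h => mem_supp.1 hY (hlt Y h))

theorem leadCoeff_eq {f : FreeMod A n r} {X : PowerProduct n r} (h : leadMonomial f = X) :
    leadCoeff f = coeffAt f X := by
  simp [leadCoeff, h]

theorem leadTerm_eq {f : FreeMod A n r} {X : PowerProduct n r} (h : leadMonomial f = X) :
    leadTerm f = monomialElt (leadCoeff f) X := by
  simp [leadTerm, h]

theorem exists_leadMonomial_eq {f : FreeMod A n r} (hf : f ≠ 0) :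
    ∃ X : PowerProduct n r, leadMonomial f = X := by
  obtain ⟨Y, hY⟩ : ∃ Y, coeffAt f Y ≠ 0 := by
    by_contra! h
    exact hf (ext_coeffAt fun X => by rw [h, coeffAt_zero])
  exact Finset.max_of_mem (mem_supp.2 hY)

theorem leadCoeff_ne_zero {f : FreeMod A n r} (hf : f ≠ 0) : leadCoeff f ≠ 0 := by
  obtain ⟨X, hX⟩ := exists_leadMonomial_eq hf
  exact leadCoeff_eq hX ▸ (leadMonomial_eq_coe.1 hX).1

theorem ne_zero_of_leadMonomial_eq {f : FreeMod A n r} {X : PowerProduct n r}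
    (h : leadMonomial f = X) : f ≠ 0 := by
  rintro rfl
  exact (leadMonomial_eq_coe.1 h).1 (coeffAt_zero X)

theorem leadMonomial_monomialElt {c : A} (hc : c ≠ 0) (X : PowerProduct n r) :
    leadMonomial (monomialElt c X) = X :=
  leadMonomial_eq_coe.2 ⟨by rwa [coeffAt_monomialElt_self],
    fun _ hY => coeffAt_monomialElt_of_ne hY.ne c⟩

theorem leadMonomial_mapCoeff {k B : Type*} [CommRing k] [Algebra k A] [CommRing B] [Algebra k B]
    {φ : A →ₗ[k] B} {f : FreeMod A n r} {X : PowerProduct n r} (hX : leadMonomial f = X)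
    (hφ : φ (leadCoeff f) ≠ 0) : leadMonomial (mapCoeff φ f) = X := by
  rw [leadMonomial_eq_coe, coeffAt_mapCoeff, ← leadCoeff_eq hX]
  refine ⟨hφ, fun Y hY => ?_⟩
  rw [coeffAt_mapCoeff, (leadMonomial_eq_coe.1 hX).2 Y hY, map_zero]

theorem leadMonomial_sub_lt {f h : FreeMod A n r} {X : PowerProduct n r}
    (hf : leadMonomial f = X) (hh : leadMonomial h = X) (hc : leadCoeff h = leadCoeff f) :
    leadMonomial (f - h) < leadMonomial f := by
  rw [leadCoeff_eq hf, leadCoeff_eq hh] at hc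
  rw [hf, leadMonomial_lt_coe]
  intro Y hY
  rw [coeffAt_sub]
  rcases hY.eq_or_lt with rfl | hY
  · rw [hc, sub_self]
  · rw [(leadMonomial_eq_coe.1 hf).2 Y hY, (leadMonomial_eq_coe.1 hh).2 Y hY, sub_zero]

/-- The leading power product of `f` divides `X`. -/
def LeadDvd (f : FreeMod A n r) (X : PowerProduct n r) : Prop :=
  ∃ (d : Fin n →₀ ℕ) (Y : PowerProduct n r), leadMonomial f = Y ∧ Y.shift d = X

theorem LeadDvd.shift {f : FreeMod A n r} {e : Fin n →₀ ℕ} {X : PowerProduct n r}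
    (h : LeadDvd f X) : LeadDvd f (X.shift e) := by
  obtain ⟨d, Y, hY, rfl⟩ := h
  exact ⟨e + d, Y, hY, PowerProduct.ext (add_assoc _ _ _) rfl⟩

theorem coeffAt_mem_of_mem_ltSubmodule {S : Set (FreeMod A n r)} {f : FreeMod A n r}
    (hf : f ∈ ltSubmodule S) (I : Ideal A) {X : PowerProduct n r}
    (hX : ∀ g ∈ S, LeadDvd g X → leadCoeff g ∈ I) : coeffAt f X ∈ I := by
  induction hf using Submodule.span_induction generalizing X with
  | mem f hf =>
    obtain ⟨g, hg, rfl⟩ := hf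
    obtain rfl | h0 := eq_or_ne g 0
    · simp [leadTerm, leadMonomial, supp, coeffAt_zero]
    obtain ⟨Y, hY⟩ := exists_leadMonomial_eq h0
    rw [leadTerm_eq hY]
    obtain rfl | hYX := eq_or_ne Y X
    · rw [coeffAt_monomialElt_self]
      exact hX g hg ⟨0, Y, hY, by simp [PowerProduct.shift]⟩
    · rw [coeffAt_monomialElt_of_ne hYX]
      exact I.zero_mem
  | zero => simp [coeffAt_zero]
  | add f g _ _ hf hg =>
    rw [coeffAt_add]
    exact I.add_mem (hf hX) (hg hX)
  | smul p f _ hf =>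
    rw [coeffAt_polynomial_smul]
    refine I.sum_mem fun x hx => I.mul_mem_left _ (hf fun g hg hd => hX g hg ?_)
    rw [← show PowerProduct.shift x.1 ⟨x.2, X.index⟩ = X from
      PowerProduct.ext (Finset.HasAntidiagonal.mem_antidiagonal.1 hx) rfl]
    exact hd.shift

theorem IsGroebnerBasis.exists_leadDvd_leadCoeff_notMem {G : Finset (FreeMod A n r)}
    {M : Submodule (MvPolynomial (Fin n) A) (FreeMod A n r)} (hG : IsGroebnerBasis G M)
    {f : FreeMod A n r} (hf : f ∈ M) {X : PowerProduct n r} (hX : leadMonomial f = X)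
    {I : Ideal A} (hI : leadCoeff f ∉ I) : ∃ g ∈ G, LeadDvd g X ∧ leadCoeff g ∉ I := by
  have hlt : leadTerm f ∈ ltSubmodule (G : Set (FreeMod A n r)) := by
    rw [hG.2]
    exact Submodule.subset_span ⟨f, hf, rfl⟩
  by_contra! hcon
  have hmem := coeffAt_mem_of_mem_ltSubmodule hlt I hcon
  rw [leadTerm_eq hX, coeffAt_monomialElt_self] at hmem
  exact hI hmem

end LeadingTerms

section TermOrder

variable {A : Type*} [CommRing A] {n r : ℕ} [LinearOrder (PowerProduct n r)]

theorem IsTermOrder.le_shift (hord : IsTermOrder n r) (X : PowerProduct n r) (d : Fin n →₀ ℕ) :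
    X ≤ X.shift d := by
  obtain rfl | hd := eq_or_ne d 0
  · simp [PowerProduct.shift]
  · exact (hord.lt_shift X d hd).le

theorem IsTermOrder.lt_of_shift_lt_shift (hord : IsTermOrder n r) {X Y : PowerProduct n r}
    {d : Fin n →₀ ℕ} (h : X.shift d < Y.shift d) : X < Y := by
  by_contra! hYX
  obtain rfl | hYX := hYX.eq_or_lt
  · exact h.false
  · exact h.asymm (hord.shift_lt_shift Y X d hYX)

theorem IsTermOrder.wellFoundedLT (hord : IsTermOrder n r) : WellFoundedLT (PowerProduct n r) := by
  rw [← wellQuasiOrderedLE_iff_wellFoundedLT]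
  refine ⟨fun X => ?_⟩
  obtain ⟨i, j, hij, hexp, hidx⟩ :=
    (wellQuasiOrdered_le (α := Fin n →₀ ℕ)).prod (Finite.wellQuasiOrdered (α := Fin r) (· = ·))
      fun i => ((X i).exponent, (X i).index)
  refine ⟨i, j, hij, ?_⟩
  have hshift : (X i).shift ((X j).exponent - (X i).exponent) = X j :=
    PowerProduct.ext (tsub_add_cancel_of_le hexp) hidx
  exact hshift ▸ hord.le_shift (X i) _

theorem IsTermOrder.leadMonomial_monomial_smul (hord : IsTermOrder n r) {p : FreeMod A n r}
    {Y : PowerProduct n r} (hp : leadMonomial p = Y) (d : Fin n →₀ ℕ) {u : A}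
    (hu : u * leadCoeff p ≠ 0) : leadMonomial (MvPolynomial.monomial d u • p) = Y.shift d := by
  rw [leadMonomial_eq_coe, coeffAt_monomial_smul_shift, ← leadCoeff_eq hp]
  refine ⟨hu, fun Z hZ => ?_⟩
  by_cases h : ∃ W : PowerProduct n r, Z = W.shift d
  · obtain ⟨W, rfl⟩ := h
    rw [coeffAt_monomial_smul_shift,
      (leadMonomial_eq_coe.1 hp).2 W (hord.lt_of_shift_lt_shift hZ), mul_zero]
  · exact coeffAt_monomial_smul_of_forall_ne (not_exists.1 h) u p

theorem IsTermOrder.leadMonomial_sub_monomial_smul_lt (hord : IsTermOrder n r)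
    {f p : FreeMod A n r} {Y : PowerProduct n r} {d : Fin n →₀ ℕ} {u : A}
    (hp : leadMonomial p = Y) (hf : leadMonomial f = Y.shift d)
    (hu : u * leadCoeff p = leadCoeff f) :
    leadMonomial (f - MvPolynomial.monomial d u • p) < leadMonomial f := by
  have hup := hord.leadMonomial_monomial_smul hp d
    (hu ▸ leadCoeff_ne_zero (ne_zero_of_leadMonomial_eq hf))
  refine leadMonomial_sub_lt hf hup ?_
  rw [leadCoeff_eq hup, coeffAt_monomial_smul_shift, ← leadCoeff_eq hp, hu]

theorem IsTermOrder.exists_reducesStrictly (hord : IsTermOrder n r) {F : Finset (FreeMod A n r)}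
    {f p : FreeMod A n r} (hpF : p ∈ F) {X : PowerProduct n r} (hf : leadMonomial f = X)
    (hdvd : LeadDvd p X) (hcoeff : leadCoeff p ∣ leadCoeff f) : ∃ h, ReducesStrictly F f h := by
  classical
  obtain ⟨d, Y, hY, rfl⟩ := hdvd
  obtain ⟨u, hu⟩ := exists_eq_mul_left_of_dvd hcoeff
  refine ⟨f - MvPolynomial.monomial d u • p, Relation.TransGen.single
    ⟨fun q => if q = p then u else 0, fun _ => d, ?_, fun q _ hq => ?_, ?_⟩,
    hord.leadMonomial_sub_monomial_smul_lt hY hf hu.symm⟩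
  · rw [Finset.sum_eq_single_of_mem p hpF fun q _ hq => by simp [hq]]
    simp only [if_true]
  · obtain rfl : q = p := of_not_not fun h => hq (if_neg h)
    rw [hf, hY, WithBot.map_coe]
  · rw [Finset.sum_eq_single_of_mem p hpF fun q _ hq => by simp [hq], leadTerm_eq hf,
      leadTerm_eq hY]
    simp only [if_true, monomial_smul_monomialElt, hu]

theorem IsTermOrder.eq_top_of_forall_exists_leadMonomial_sub_lt (hord : IsTermOrder n r)
    {N : Submodule A (FreeMod A n r)}
    (hN : ∀ f : FreeMod A n r, f ≠ 0 → ∃ q ∈ N, leadMonomial (f - q) < leadMonomial f) :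
    N = ⊤ := by
  have := hord.wellFoundedLT
  refine Submodule.eq_top_iff'.2 fun f => ?_
  induction hX : leadMonomial f using WellFoundedLT.induction generalizing f with
  | ind _ ih =>
    subst hX
    obtain rfl | h0 := eq_or_ne f 0
    · exact N.zero_mem
    obtain ⟨q, hq, hlt⟩ := hN f h0
    exact (N.sub_mem_iff_left hq).1 (ih _ hlt (f - q) rfl)

end TermOrder

section StandardMonomials

variable {A : Type*} [CommRing A] {n r : ℕ} [LinearOrder (PowerProduct n r)]
  {G : Finset (FreeMod A n r)} {M : Submodule (MvPolynomial (Fin n) A) (FreeMod A n r)}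

/-- The standard power products of `G`: those divisible by no leading power product of an element
of `G`. -/
def standardMonomials (G : Finset (FreeMod A n r)) : Set (PowerProduct n r) :=
  {X | ∀ g ∈ G, ¬ LeadDvd g X}

/-- The `A`-submodule of `L` spanned by the standard power products of `G`. -/
noncomputable def standardSubmodule (G : Finset (FreeMod A n r)) : Submodule A (FreeMod A n r) :=
  Submodule.span A (powerProductBasis A n r '' standardMonomials G)

theorem mem_standardSubmodule {f : FreeMod A n r} :
    f ∈ standardSubmodule G ↔ ∀ X, coeffAt f X ≠ 0 → X ∈ standardMonomials G := by
  simp [standardSubmodule, Module.Basis.mem_span_image, Set.subset_def,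
    powerProductBasis_repr_apply]

instance standardSubmodule.free : Module.Free A (standardSubmodule G) := by
  rw [standardSubmodule, Set.image_eq_range]
  exact Module.Free.of_basis (Module.Basis.span
    ((powerProductBasis A n r).linearIndependent.comp _ Subtype.val_injective))

theorem IsGroebnerBasis.disjoint_standardSubmodule (hG : IsGroebnerBasis G M) :
    Disjoint (M.restrictScalars A) (standardSubmodule G) := by
  refine Submodule.disjoint_def.2 fun f hfM hfS => ?_
  by_contra h0
  obtain ⟨X, hX⟩ := exists_leadMonomial_eq h0
  obtain ⟨g, hg, hdvd, -⟩ :=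
    hG.exists_leadDvd_leadCoeff_notMem hfM hX (I := ⊥) (leadCoeff_ne_zero h0)
  exact mem_standardSubmodule.1 hfS X (leadMonomial_eq_coe.1 hX).1 g hg hdvd

theorem IsTermOrder.sup_standardSubmodule_eq_top (hord : IsTermOrder n r) (hGM : ∀ g ∈ G, g ∈ M)
    (hunit : ∀ g ∈ G, IsUnit (leadCoeff g)) :
    M.restrictScalars A ⊔ standardSubmodule G = ⊤ := by
  refine hord.eq_top_of_forall_exists_leadMonomial_sub_lt fun f h0 => ?_
  obtain ⟨X, hX⟩ := exists_leadMonomial_eq h0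
  by_cases hstd : X ∈ standardMonomials G
  · have hlead := leadMonomial_monomialElt (leadCoeff_ne_zero h0) X
    refine ⟨monomialElt (leadCoeff f) X, Submodule.mem_sup_right
      (mem_standardSubmodule.2 fun Y hY => ?_), leadMonomial_sub_lt hX hlead ?_⟩
    · obtain rfl : X = Y := by_contra fun h => hY (coeffAt_monomialElt_of_ne h _)
      exact hstd
    · rw [leadCoeff_eq hlead, coeffAt_monomialElt_self]
  · obtain ⟨g, hg, d, Y, hY, rfl⟩ : ∃ g ∈ G, LeadDvd g X := by
      simpa [standardMonomials] using hstd
    obtain ⟨u, hu⟩ := exists_eq_mul_left_of_dvd ((hunit g hg).dvd (a := leadCoeff f))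
    exact ⟨MvPolynomial.monomial d u • g, Submodule.mem_sup_left (M.smul_mem _ (hGM g hg)),
      hord.leadMonomial_sub_monomial_smul_lt hY hX hu.symm⟩

theorem IsGroebnerBasis.free_quotient_of_isUnit_leadCoeff (hord : IsTermOrder n r)
    (hG : IsGroebnerBasis G M) (hunit : ∀ g ∈ G, IsUnit (leadCoeff g)) :
    Module.Free A (FreeMod A n r ⧸ M) := by
  have hcompl : IsCompl (M.restrictScalars A) (standardSubmodule G) :=
    ⟨hG.disjoint_standardSubmodule, codisjoint_iff.2 <|
      hord.sup_standardSubmodule_eq_top (fun g hg => (hG.1 g hg).1) hunit⟩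
  exact Module.Free.of_equiv ((Submodule.quotientEquivOfIsCompl _ _ hcompl).symm.trans
    (Submodule.Quotient.restrictScalarsEquiv A M))

end StandardMonomials

theorem exists_mem_ker_sum_smul_eq_of_flat {A E Q ι : Type*} [CommRing A] [AddCommGroup E]
    [Module A E] [AddCommGroup Q] [Module A Q] [Module.Flat A Q] [Fintype ι] (π : E →ₗ[A] Q)
    (hπ : Function.Surjective π) (c : ι → A) (v : ι → E) (h : ∑ i, c i • v i ∈ π.ker) :
    ∃ w : ι → E, (∀ i, w i ∈ π.ker) ∧ ∑ i, c i • w i = ∑ i, c i • v i := by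
  have hrel : ∑ i, c i • π (v i) = 0 := by simpa using h
  obtain ⟨κ, b, y, hy, hb⟩ := Module.Flat.isTrivialRelation_of_sum_smul_eq_zero hrel
  choose z hz using fun j => hπ (y j)
  refine ⟨fun i => v i - ∑ j, b i j • z j, fun i => ?_, ?_⟩
  · simp [hy, hz]
  · have hzero : ∑ i, c i • ∑ j, b i j • z j = 0 := by
      simp_rw [Finset.smul_sum, smul_smul]
      rw [Finset.sum_comm]
      simp_rw [← Finset.sum_smul, hb, zero_smul, Finset.sum_const_zero]
    simp_rw [smul_sub, Finset.sum_sub_distrib, hzero, sub_zero]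

section Graded

theorem notMem_irrelevant_of_mem_zero {A σ : Type*} [CommRing A] [SetLike σ A]
    [AddSubmonoidClass σ A] {𝒜 : ℕ → σ} [GradedRing 𝒜] {x : A} (hx : x ∈ 𝒜 0) (h0 : x ≠ 0) :
    x ∉ (HomogeneousIdeal.irrelevant 𝒜).toIdeal := fun h => h0 <| by
  rwa [← DirectSum.decompose_of_mem_same 𝒜 hx, ← GradedRing.proj_apply,
    ← HomogeneousIdeal.mem_irrelevant_iff]

variable {k A : Type*} [Field k] [CommRing A] [Algebra k A] {𝒜 : ℕ → Submodule k A}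
  {n r : ℕ} {M : Submodule (MvPolynomial (Fin n) A) (FreeMod A n r)}

theorem mapCoeff_eq_smul_of_mem_degreePart_zero (h𝒜 : 𝒜 0 = 1) (φ : A →ₗ[k] A)
    {f : FreeMod A n r} (hf : f ∈ degreePart 𝒜 n r 0) : mapCoeff φ f = φ 1 • f :=
  ext_coeffAt fun X => by
    obtain ⟨c, hc⟩ := Submodule.mem_one.1 (h𝒜 ▸ hf X)
    rw [coeffAt_mapCoeff, coeffAt_smul, ← hc, Algebra.algebraMap_eq_smul_one, map_smul,
      mul_smul_comm, mul_one]

theorem isUnit_of_mem_zero_of_ne_zero (h𝒜 : 𝒜 0 = 1) {x : A} (hx : x ∈ 𝒜 0) (h0 : x ≠ 0) :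
    IsUnit x := by
  obtain ⟨c, rfl⟩ := Submodule.mem_one.1 (h𝒜 ▸ hx)
  exact (IsUnit.mk0 c fun hc => h0 (hc ▸ map_zero _)).map (algebraMap k A)

theorem leadCoeff_mem_of_mem_degreePart [LinearOrder (PowerProduct n r)] {i : ℕ}
    {f : FreeMod A n r} (hf : f ∈ degreePart 𝒜 n r i) : leadCoeff f ∈ 𝒜 i := by
  rw [leadCoeff]
  cases leadMonomial f with
  | bot => exact (𝒜 i).zero_mem
  | coe X => exact hf X

theorem IsGradedSubmodule.le_of_forall_degreePart (hM : IsGradedSubmodule 𝒜 M)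
    {N : Submodule k (FreeMod A n r)} (hN : ∀ i, ∀ f ∈ M, f ∈ degreePart 𝒜 n r i → f ∈ N) :
    M.restrictScalars k ≤ N :=
  hM.trans_le (iSup_le fun i f hf => hN i f hf.1 hf.2)

theorem mapCoeff_mem_of_mem_span_inter_degreePart_zero (h𝒜 : 𝒜 0 = 1) {f : FreeMod A n r}
    (hf : f ∈ Submodule.span A ((M : Set (FreeMod A n r)) ∩ degreePart 𝒜 n r 0))
    (φ : A →ₗ[k] A) : mapCoeff φ f ∈ M := by
  induction hf using Submodule.span_induction generalizing φ with
  | mem f hf =>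
    rw [mapCoeff_eq_smul_of_mem_degreePart_zero h𝒜 φ hf.2]
    exact M.smul_of_tower_mem _ hf.1
  | zero => simp
  | add f g _ _ hf hg =>
    rw [map_add]
    exact M.add_mem (hf φ) (hg φ)
  | smul a f _ hf =>
    have hsmul : mapCoeff φ (a • f) = mapCoeff (φ ∘ₗ LinearMap.mulLeft k a) f :=
      ext_coeffAt fun X => by simp [coeffAt_mapCoeff, coeffAt_smul]
    exact hsmul ▸ hf _

variable [GradedAlgebra 𝒜]

theorem IsGradedTdvr.zero_eq_one {a : ℕ∞} (hA : IsGradedTdvr 𝒜 a) : 𝒜 0 = 1 :=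
  (hA.eq_pow 0 hA.length_pos).trans (pow_zero _)

theorem mapCoeff_proj_mem_degreePart (i : ℕ) (f : FreeMod A n r) :
    mapCoeff (GradedAlgebra.proj 𝒜 i) f ∈ degreePart 𝒜 n r i := fun X => by
  rw [coeffAt_mapCoeff, GradedAlgebra.proj_apply]
  exact SetLike.coe_mem _

theorem mapCoeff_proj_of_mem_same {i : ℕ} {f : FreeMod A n r} (hf : f ∈ degreePart 𝒜 n r i) :
    mapCoeff (GradedAlgebra.proj 𝒜 i) f = f := ext_coeffAt fun X => by
  rw [coeffAt_mapCoeff, GradedAlgebra.proj_apply, DirectSum.decompose_of_mem_same 𝒜 (hf X)]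

theorem mapCoeff_proj_of_mem_ne {i j : ℕ} (hij : i ≠ j) {f : FreeMod A n r}
    (hf : f ∈ degreePart 𝒜 n r i) : mapCoeff (GradedAlgebra.proj 𝒜 j) f = 0 :=
  ext_coeffAt fun X => by
    rw [coeffAt_mapCoeff, GradedAlgebra.proj_apply, DirectSum.decompose_of_mem_ne 𝒜 (hf X) hij,
      coeffAt_zero]

theorem mapCoeff_proj_smul {i : ℕ} {c : A} (hc : c ∈ 𝒜 i) (f : FreeMod A n r) :
    mapCoeff (GradedAlgebra.proj 𝒜 i) (c • f) = c • mapCoeff (GradedAlgebra.proj 𝒜 0) f :=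
  ext_coeffAt fun X => by
    simp only [coeffAt_mapCoeff, coeffAt_smul, GradedAlgebra.proj_apply]
    simpa using DirectSum.coe_decompose_mul_add_of_left_mem 𝒜 (j := 0) hc

theorem IsGradedSubmodule.mapCoeff_proj_mem (hM : IsGradedSubmodule 𝒜 M) (i : ℕ)
    {m : FreeMod A n r} (hm : m ∈ M) : mapCoeff (GradedAlgebra.proj 𝒜 i) m ∈ M := by
  refine hM.le_of_forall_degreePart
    (N := (M.restrictScalars k).comap (mapCoeff (GradedAlgebra.proj 𝒜 i))) (fun j f hf hfj => ?_) hm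
  rw [Submodule.mem_comap, Submodule.restrictScalars_mem]
  obtain rfl | hji := eq_or_ne j i
  · rwa [mapCoeff_proj_of_mem_same hfj]
  · rw [mapCoeff_proj_of_mem_ne hji hfj]
    exact M.zero_mem

theorem IsGradedSubmodule.mem_span_inter_degreePart_zero_of_flat (hM : IsGradedSubmodule 𝒜 M)
    [Module.Flat A (FreeMod A n r ⧸ M)] {m : FreeMod A n r} (hm : m ∈ M) :
    m ∈ Submodule.span A ((M : Set (FreeMod A n r)) ∩ degreePart 𝒜 n r 0) := by
  refine hM.le_of_forall_degreePart (N := (Submodule.span A _).restrictScalars k)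
    (fun i f hf hfi => ?_) hm
  obtain ⟨w, hw, hsum⟩ := exists_mem_ker_sum_smul_eq_of_flat (M.mkQ.restrictScalars A)
    M.mkQ_surjective (fun X : supp f => coeffAt f X) (fun X => powerProductBasis A n r X)
    (by simpa [-Finset.univ_eq_attach, sum_coeffAt_smul_powerProductBasis] using hf)
  have hwM : ∀ X, w X ∈ M := by simpa using hw
  have hf_eq : f = ∑ X : supp f, coeffAt f X • mapCoeff (GradedAlgebra.proj 𝒜 0) (w X) := by
    calc f = mapCoeff (GradedAlgebra.proj 𝒜 i) (∑ X : supp f, coeffAt f X • w X) := by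
          rw [hsum, sum_coeffAt_smul_powerProductBasis, mapCoeff_proj_of_mem_same hfi]
      _ = _ := by simp_rw [map_sum, mapCoeff_proj_smul (hfi _)]
  rw [Submodule.restrictScalars_mem, hf_eq]
  exact Submodule.sum_mem _ fun X _ => Submodule.smul_mem _ _ <| Submodule.subset_span
    ⟨hM.mapCoeff_proj_mem 0 (hwM X), mapCoeff_proj_mem_degreePart 0 (w X)⟩

theorem isUnit_of_mem_of_notMem_irrelevant (h𝒜 : 𝒜 0 = 1) {i : ℕ} {x : A} (hx : x ∈ 𝒜 i)
    (hirr : x ∉ (HomogeneousIdeal.irrelevant 𝒜).toIdeal) : IsUnit x := by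
  obtain rfl : i = 0 := by
    by_contra hi
    exact hirr (HomogeneousIdeal.mem_irrelevant_of_mem 𝒜 (Nat.pos_of_ne_zero hi) hx)
  exact isUnit_of_mem_zero_of_ne_zero h𝒜 hx fun h0 => hirr (h0 ▸ Ideal.zero_mem _)

theorem IsGradedSubmodule.exists_leadCoeff_mem_zero_of_flat [LinearOrder (PowerProduct n r)]
    (hM : IsGradedSubmodule 𝒜 M) (h𝒜 : 𝒜 0 = 1) [Module.Flat A (FreeMod A n r ⧸ M)]
    {m : FreeMod A n r} (hm : m ∈ M) {X : PowerProduct n r} (hX : leadMonomial m = X) :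
    ∃ m' ∈ M, leadMonomial m' = X ∧ leadCoeff m' ∈ 𝒜 0 := by
  have hc := leadCoeff_ne_zero (ne_zero_of_leadMonomial_eq hX)
  have : Nontrivial A := nontrivial_of_ne _ _ hc
  obtain ⟨χ, hχ⟩ : ∃ χ : Module.Dual k A, χ (leadCoeff m) ≠ 0 := by
    simpa using (Module.forall_dual_apply_eq_zero_iff k (leadCoeff m)).not.2 hc
  let φ : A →ₗ[k] A := Algebra.linearMap k A ∘ₗ χ
  have hX' : leadMonomial (mapCoeff φ m) = X :=
    leadMonomial_mapCoeff hX ((map_ne_zero (algebraMap k A)).2 hχ)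
  refine ⟨mapCoeff φ m, mapCoeff_mem_of_mem_span_inter_degreePart_zero h𝒜
    (hM.mem_span_inter_degreePart_zero_of_flat hm) φ, hX', ?_⟩
  rw [leadCoeff_eq hX', coeffAt_mapCoeff]
  exact SetLike.algebraMap_mem_graded 𝒜 (χ (coeffAt m X))

theorem IsGroebnerBasis.exists_leadDvd_isUnit_leadCoeff_of_flat [LinearOrder (PowerProduct n r)]
    (h𝒜 : 𝒜 0 = 1) (hM : IsGradedSubmodule 𝒜 M) {G : Finset (FreeMod A n r)}
    (hG : IsGroebnerBasis G M) (hhom : ∀ g ∈ G, IsHomogeneousElt 𝒜 g)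
    [Module.Flat A (FreeMod A n r ⧸ M)] {m : FreeMod A n r} (hm : m ∈ M)
    {X : PowerProduct n r} (hX : leadMonomial m = X) :
    ∃ g ∈ G, LeadDvd g X ∧ IsUnit (leadCoeff g) := by
  obtain ⟨m', hm', hX', hzero⟩ := hM.exists_leadCoeff_mem_zero_of_flat h𝒜 hm hX
  obtain ⟨g, hg, hdvd, hirr⟩ := hG.exists_leadDvd_leadCoeff_notMem hm' hX' <|
    notMem_irrelevant_of_mem_zero hzero (leadCoeff_ne_zero (ne_zero_of_leadMonomial_eq hX'))
  obtain ⟨-, i, hgi⟩ := hhom g hg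
  exact ⟨g, hg, hdvd,
    isUnit_of_mem_of_notMem_irrelevant h𝒜 (leadCoeff_mem_of_mem_degreePart hgi) hirr⟩

end Graded

theorem IsMinimalBasis.eq_of_leadDvd_of_isUnit {A : Type*} [CommRing A] {n r : ℕ}
    [LinearOrder (PowerProduct n r)] (hord : IsTermOrder n r) {G : Finset (FreeMod A n r)}
    (hmin : IsMinimalBasis G) {g h : FreeMod A n r} (hg : g ∈ G) (hh : h ∈ G)
    {X : PowerProduct n r} (hX : leadMonomial g = X) (hdvd : LeadDvd h X)
    (hunit : IsUnit (leadCoeff h)) : h = g := by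
  classical
  by_contra hne
  refine hmin g hg ?_
  convert hord.exists_reducesStrictly (Finset.mem_erase.2 ⟨hne, hh⟩) hX hdvd hunit.dvd

end GroebnerFlat

theorem mainTheorem3_general {k A : Type*} [Field k] [CommRing A] [Algebra k A]
    (𝒜 : ℕ → Submodule k A) [GradedAlgebra 𝒜] (h𝒜 : 𝒜 0 = 1)
    (n r : ℕ) [LinearOrder (PowerProduct n r)] (hord : IsTermOrder n r)
    (M : Submodule (MvPolynomial (Fin n) A) (FreeMod A n r)) (hM : IsGradedSubmodule 𝒜 M)
    (G : Finset (FreeMod A n r)) (hG : IsGroebnerBasis G M)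
    (hhom : ∀ g ∈ G, IsHomogeneousElt 𝒜 g) (hmin : IsMinimalBasis G) :
    Module.Flat A (FreeMod A n r ⧸ M) ↔ ∀ g ∈ G, IsUnit (leadCoeff g) := by
  refine ⟨fun hflat g hg => ?_, fun hunit => ?_⟩
  · obtain ⟨X, hX⟩ := exists_leadMonomial_eq (hG.1 g hg).2
    obtain ⟨h, hh, hdvd, hunit⟩ :=
      hG.exists_leadDvd_isUnit_leadCoeff_of_flat h𝒜 hM hhom (hG.1 g hg).1 hX
    exact hmin.eq_of_leadDvd_of_isUnit hord hg hh hX hdvd hunit ▸ hunit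
  · have := hG.free_quotient_of_isUnit_leadCoeff hord hunit
    infer_instance

theorem mainTheorem3 {k A : Type*} [Field k] [CommRing A] [Algebra k A]
    (𝒜 : ℕ → Submodule k A) [GradedAlgebra 𝒜] (a : ℕ∞) (hA : IsGradedTdvr 𝒜 a)
    (n r : ℕ) [LinearOrder (PowerProduct n r)] (hord : IsTermOrder n r)
    (M : Submodule (MvPolynomial (Fin n) A) (FreeMod A n r)) (hM0 : M ≠ ⊥)
    (hM : IsGradedSubmodule 𝒜 M)
    (G : Finset (FreeMod A n r)) (hG : IsGroebnerBasis G M)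
    (hhom : ∀ g ∈ G, IsHomogeneousElt 𝒜 g) (hmin : IsMinimalBasis G) :
    Module.Flat A (FreeMod A n r ⧸ M) ↔ ∀ g ∈ G, IsUnit (leadCoeff g) :=
  mainTheorem3_general 𝒜 hA.zero_eq_one n r hord M hM G hG hhom hmin
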